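/- Conventions. All categories have small hom sets unless stated otherwise. Let $\mathcal T$ be a triangulated category with all small coproducts and suspension $\Sigma$. An object $X$ is compact if $\bigoplus_\alpha \mathcal T(X,Y_\alpha)\to\mathcal T(X,\bigoplus_\alpha Y_\alpha)$ is an isomorphism for every small family $(Y_\alpha)$; $\mathcal T_c$ is the full subcategory of compact objects. A localising subcategory is a full triangulated subcategory closed under retracts and under all small coproducts. $\mathcal T$ is compactly generated if $\mathcal T_c$ is essentially small and $\mathcal T$ is its only localising subcategory containing $\mathcal T_c$. For a full subcategory $\mathcal U\subseteq\mathcal T$ put $\mathcal U^\perp=\{Y : \mathcal T(U,Y)=0 \text{ for all } U\in\mathcal U\}$; $X/\mathcal U$ (resp. $\mathcal U/X$) is the comma category of morphisms $X\to U$ (resp. $U\to X$) with $U\in\mathcal U$; and $\mathcal T/\mathcal U$ is the Verdier quotient, the (possibly not locally small) localisation of $\mathcal T$ at the morphisms with cone in $\mathcal U$. A set $\mathcal J$ of objects of a category is weakly initial if every object $X$ of the category admits a morphism $T\to X$ with $T\in\mathcal J$. A homology theory is a functor $K\colon\mathcal T\to\mathrm{Ab}$ that preserves all small coproducts and sends distinguished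 triangles to exact sequences; $\ker(K_*)=\{X : K(\Sigma^nX)=0\text{ for all }n\in\mathbb Z\}$. We say that $\mathcal U$ has Bousfield localisation triangles if for each $X\in\mathcal T$ there is a distinguished triangle $$CX\xrightarrow{q}X\xrightarrow{j}LX\xrightarrow{d}\Sigma CX$$ with $CX\in\mathcal U$ and $LX\in\mathcal U^\perp$, such that $q$ is terminal in $\mathcal U/X$ and $j$ is initial in $X/\mathcal U^\perp$. Theorem. Let $\mathcal T$ be a compactly generated triangulated category with small coproducts. (1) Let $K\colon\mathcal T\to\mathrm{Ab}$ be a homology theory and $\mathcal U=\ker(K_*)$. Then $\mathcal U$ is a localising subcategory of $\mathcal T$; for every $X\in\mathcal T$ the category $X/\mathcal U$ has a weakly initial (small) set of objects; the Verdier quotient $\mathcal T/\mathcal U$ has small hom sets; and $\mathcal U$ has Bousfield localisation triangles. (2) More generally, if $\mathcal U$ is any localising subcategory of $\mathcal T$ such that $\mathcal T/\mathcal U$ has small hom sets, then $\mathcal U$ has Bousfield localisation triangles. -/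

import Mathlib

open CategoryTheory Limits Pretriangulated Opposite

universe w v u

namespace BousfieldLoc

/-- A category has a (`w`-small) weakly initial set: a `w`-small set `s` of objects such that
every object receives a morphism from some member of `s`. -/
def HasWeaklyInitialSet (J : Type*) [Category J] : Prop :=
  ∃ s : Set J, Small.{w} s ∧ ∀ X : J, ∃ T ∈ s, Nonempty (T ⟶ X)

section Preadditive

variable {C : Type u} [Category.{v} C] [Preadditive C]

/-- The property of being a compact object: the functor `[X, -] : C ⥤ Ab` preserves all small
coproducts, i.e. all the natural maps `⨁ [X, Y i] ⟶ [X, ∐ Y]` are isomorphisms. -/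
def compactObjects (C : Type u) [Category.{v} C] [Preadditive C] : ObjectProperty C :=
  fun X => ∀ ι : Type v,
    PreservesColimitsOfShape (Discrete ι) (preadditiveCoyoneda.obj (op X))

end Preadditive

section Triangulated

variable {C : Type u} [Category.{v} C] [HasZeroObject C] [HasShift C ℤ] [Preadditive C]
  [∀ n : ℤ, (shiftFunctor C n).Additive] [Pretriangulated C]

/-- A thick subcategory: a (full) triangulated subcategory closed under retracts. -/
structure IsThick (U : ObjectProperty C) : Prop where
  isTriangulated : U.IsTriangulated
  isStableUnderRetracts : U.IsStableUnderRetracts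

/-- A localising subcategory: a thick subcategory closed under all small coproducts. -/
structure IsLocalising (U : ObjectProperty C) : Prop extends IsThick U where
  isClosedUnderCoproducts : ∀ ι : Type v, U.IsClosedUnderColimitsOfShape (Discrete ι)

/-- A triangulated category is compactly generated if its compact objects form an essentially
small subcategory, and the only localising subcategory containing them is the whole category. -/
structure IsCompactlyGeneratedCategory (C : Type u) [Category.{v} C] [HasZeroObject C] [HasShift C ℤ]
    [Preadditive C] [∀ n : ℤ, (shiftFunctor C n).Additive] [Pretriangulated C] : Prop where
  essentiallySmall : ObjectProperty.EssentiallySmall.{v} (compactObjects C)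
  eq_top : ∀ U : ObjectProperty C, IsLocalising U → compactObjects C ≤ U → U = ⊤

/-- A homology theory: a functor to abelian groups that sends distinguished triangles to exact
sequences and preserves all small coproducts. -/
structure IsHomologyTheory (K : C ⥤ AddCommGrpCat.{v}) : Prop where
  isHomological : K.IsHomological
  preservesCoproducts : ∀ ι : Type v, PreservesColimitsOfShape (Discrete ι) K

/-- The Verdier quotient `C/U`: the localisation of `C` at the morphisms whose cone is in `U`. -/
abbrev VerdierQuotient (U : ObjectProperty C) := U.trW.Localization

/-- The category `X/U` of morphisms from `X` to objects of `U`. -/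
abbrev ObjectsUnder (X : C) (U : ObjectProperty C) := StructuredArrow X U.ι

/-- The category `U/X` of morphisms from objects of `U` to `X`. -/
abbrev ObjectsOver (U : ObjectProperty C) (X : C) := CostructuredArrow U.ι X

/-- Bousfield localisation triangles for `U`: every `X` lies in a distinguished triangle
`CX ⟶ X ⟶ LX ⟶ CX⟦1⟧` with `CX` in `U` and `LX` in `U^⊥` (the objects `Y` such that every
morphism from an object of `U` to `Y` is zero), where moreover `CX ⟶ X` is terminal in `U/X` and
`X ⟶ LX` is initial in `X/U^⊥`. -/
def HasBousfieldTriangles (U : ObjectProperty C) : Prop :=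
  ∀ X : C, ∃ (CX LX : C) (q : CX ⟶ X) (j : X ⟶ LX) (d : LX ⟶ CX⟦(1 : ℤ)⟧)
    (hCX : U CX) (hLX : U.rightOrthogonal LX),
    Triangle.mk q j d ∈ distTriang C ∧
    Nonempty (IsTerminal (CostructuredArrow.mk (S := U.ι)
      (Y := (⟨CX, hCX⟩ : U.FullSubcategory)) q : ObjectsOver U X)) ∧
    Nonempty (IsInitial (StructuredArrow.mk (T := U.rightOrthogonal.ι)
      (Y := (⟨LX, hLX⟩ : U.rightOrthogonal.FullSubcategory)) j :
        ObjectsUnder X U.rightOrthogonal))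

end Triangulated

end BousfieldLoc

/-!
# Bousfield localisation triangles in compactly generated triangulated categories

Let `U` be a localising subcategory of a compactly generated triangulated category `C`.

If `C/U` is locally small, then for each `X` the functor `Y ↦ (C/U)(Y, X)` is cohomological
on `C` (`isCohomological_quotientYoneda`) and has small values, so Brown representability
(`exists_representing`) gives an object `L` and a universal morphism `ξ : L ⟶ X` in `C/U`. The
object `L` is right orthogonal to `U`, and morphisms into such objects are the same in `C` and in
`C/U`; hence `ξ` is inverse to the image of a morphism `j : X ⟶ L` of `C`. The fibre of `j` dies in
`C/U`, so it is a retract of an object of `U`, and belongs to `U`. The universal properties of the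
triangle then follow from orthogonality (`bousfieldTriangle_universal`).

When `U` is the kernel of a homology theory `K`, the smallness of `C/U` comes from weakly initial
sets in the categories `X/U`: the denominators of right fractions out of `X` can be taken
among the fibres of the morphisms in such a set (`locallySmall_verdierQuotient`). To find
the set, one first shows by dévissage that `K` is determined by compact objects
(`compactlySupported_all`). Given `f : X ⟶ V` with `V` in `U`, attach to `X` one cell along each
morphism from a compact object to `X` whose composition with `f` is zero. Then `f` extends, and all
elements of `K X`, in all degrees, die in the result: such an element comes from the fibre of `f`,
where it is supported on a compact object. Iterating, `f` factors through the homotopy colimit of a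
sequence, on which `K` vanishes, and only a small set of sequences can arise
(`exists_factor_homologicalKernel`).

Brown representability rests on the same construction (`IsCohomological.exists_telescope`), in which
`f` is replaced by an element of an arbitrary cohomological functor.
-/

namespace BousfieldLoc

/-! ### Elements of abelian groups obtained from functors -/

section Elements

variable {C : Type*} [Category C] (K : C ⥤ AddCommGrpCat.{w})

lemma map_comp_elt {X Y Z : C} (f : X ⟶ Y) (g : Y ⟶ Z) (x : K.obj X) :
    K.map (f ≫ g) x = K.map g (K.map f x) := by
  simp

lemma map_id_elt {X : C} (x : K.obj X) : K.map (𝟙 X) x = x := by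
  simp

section

variable [Preadditive C] [K.Additive]

lemma map_add_elt {X Y : C} (f g : X ⟶ Y) (x : K.obj X) :
    K.map (f + g) x = K.map f x + K.map g x := by
  rw [K.map_add]; rfl

lemma map_sub_elt {X Y : C} (f g : X ⟶ Y) (x : K.obj X) :
    K.map (f - g) x = K.map f x - K.map g x := by
  rw [K.map_sub]; rfl

lemma map_neg_elt {X Y : C} (f : X ⟶ Y) (x : K.obj X) :
    K.map (-f) x = - K.map f x := by
  rw [K.map_neg]; rfl

lemma map_zero_elt {X Y : C} (x : K.obj X) :
    K.map (0 : X ⟶ Y) x = 0 := by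
  rw [K.map_zero]; rfl

lemma map_sum_elt {ι : Type*} {X Y : C} (s : Finset ι) (f : ι → (X ⟶ Y)) (x : K.obj X) :
    K.map (∑ i ∈ s, f i) x = ∑ i ∈ s, K.map (f i) x := by
  classical
  induction s using Finset.induction_on with
  | empty => simp
  | insert a s ha ih => rw [Finset.sum_insert ha, Finset.sum_insert ha, map_add_elt, ih]

end

lemma isZero_of_forall_eq_zero {A : AddCommGrpCat.{w}} (h : ∀ x : A, x = 0) : IsZero A :=
  by
  have : Subsingleton A := ⟨fun x y => (h x).trans (h y).symm⟩
  exact AddCommGrpCat.isZero_of_subsingleton A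

lemma eq_zero_of_isZero {A : AddCommGrpCat.{w}} (h : IsZero A) (x : A) : x = 0 := by
  have := AddCommGrpCat.subsingleton_of_isZero h
  exact Subsingleton.elim _ _

end Elements

/-! ### Finite truncations of a coproduct -/

section Truncation

variable {C : Type u} [Category.{v} C] [Preadditive C] {ι : Type*} (X : ι → C) [HasCoproduct X]

/-- The projection of a coproduct onto one of its summands. -/
noncomputable def coord (i : ι) : ∐ X ⟶ X i :=
  letI := Classical.decEq ι
  Sigma.π X i

lemma ι_coord_self (i : ι) : Sigma.ι X i ≫ coord X i = 𝟙 _ := by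
  classical
  exact Sigma.ι_π_eq_id X i

lemma ι_coord_of_ne {i j : ι} (h : i ≠ j) : Sigma.ι X i ≫ coord X j = 0 := by
  classical
  exact Sigma.ι_π_of_ne X h

/-- The idempotent endomorphism of a coproduct projecting onto the summands indexed by a
finite set. -/
noncomputable def trunc (s : Finset ι) : ∐ X ⟶ ∐ X := ∑ i ∈ s, coord X i ≫ Sigma.ι X i

lemma ι_trunc_of_mem {s : Finset ι} {i : ι} (h : i ∈ s) :
    Sigma.ι X i ≫ trunc X s = Sigma.ι X i := by
  rw [trunc, Preadditive.comp_sum, Finset.sum_eq_single_of_mem i h]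
  · rw [reassoc_of% (ι_coord_self X i)]
  · intro j _ hj
    rw [reassoc_of% (ι_coord_of_ne X hj.symm), zero_comp]

lemma ι_trunc_of_notMem {s : Finset ι} {i : ι} (h : i ∉ s) :
    Sigma.ι X i ≫ trunc X s = 0 := by
  rw [trunc, Preadditive.comp_sum]
  refine Finset.sum_eq_zero fun j hj => ?_
  rw [reassoc_of% (ι_coord_of_ne X (i := i) (j := j) (by rintro rfl; exact h hj)), zero_comp]

lemma trunc_coord_of_notMem {s : Finset ι} {i : ι} (h : i ∉ s) : trunc X s ≫ coord X i = 0 := by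
  rw [trunc, Preadditive.sum_comp]
  refine Finset.sum_eq_zero fun j hj => ?_
  rw [Category.assoc, ι_coord_of_ne X (by rintro rfl; exact h hj), comp_zero]

lemma trunc_comp_of_subset {s t : Finset ι} (h : s ⊆ t) :
    trunc X s ≫ trunc X t = trunc X s := by
  refine Sigma.hom_ext _ _ fun i => ?_
  by_cases hi : i ∈ s
  · rw [reassoc_of% (ι_trunc_of_mem X hi), ι_trunc_of_mem X hi, ι_trunc_of_mem X (h hi)]
  · rw [reassoc_of% (ι_trunc_of_notMem X hi), ι_trunc_of_notMem X hi, zero_comp]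

variable (K : C ⥤ AddCommGrpCat.{w})

/-- The elements of the value on a coproduct that are supported on finitely many summands. -/
def finitelySupported : AddSubgroup (K.obj (∐ X)) where
  carrier := {x | ∃ s, K.map (trunc X s) x = x}
  zero_mem' := ⟨∅, by simp⟩
  add_mem' := by
    classical
    rintro x y ⟨s, hs⟩ ⟨t, ht⟩
    refine ⟨s ∪ t, ?_⟩
    rw [map_add, ← hs, ← ht, ← map_comp_elt, ← map_comp_elt,
      trunc_comp_of_subset X Finset.subset_union_left,
      trunc_comp_of_subset X Finset.subset_union_right]
  neg_mem' := by
    rintro x ⟨s, hs⟩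
    exact ⟨s, by rw [map_neg, hs]⟩

/-- If a functor preserves a coproduct, each element of its value there is supported on finitely
many summands: the quotient by the finitely supported elements is killed by all the inclusions
of the summands. -/
lemma exists_map_trunc_eq [PreservesColimitsOfShape (Discrete ι) K] (x : K.obj (∐ X)) :
    ∃ s, K.map (trunc X s) x = x := by
  let H := finitelySupported X K
  let q : K.obj (∐ X) ⟶ AddCommGrpCat.of (K.obj (∐ X) ⧸ H) :=
    AddCommGrpCat.ofHom (QuotientAddGroup.mk' H)
  have hq : q = 0 := by
    refine (isColimitOfPreserves K (coproductIsCoproduct X)).hom_ext fun ⟨i⟩ => ?_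
    ext y
    refine (QuotientAddGroup.eq_zero_iff _).2 ?_
    refine ⟨{i}, ?_⟩
    change K.map (trunc X {i}) (K.map (Sigma.ι X i) y) = K.map (Sigma.ι X i) y
    rw [← map_comp_elt, ι_trunc_of_mem X (Finset.mem_singleton_self i)]
  have : q x = 0 := by rw [hq]; rfl
  exact (QuotientAddGroup.eq_zero_iff _).1 this

variable [K.Additive]

lemma map_trunc_elt (s : Finset ι) (x : K.obj (∐ X)) :
    K.map (trunc X s) x = ∑ i ∈ s, K.map (Sigma.ι X i) (K.map (coord X i) x) := by
  simp only [trunc, map_sum_elt, map_comp_elt]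

/-- If a functor preserves a coproduct, elements of its value there are determined by their
coordinates. -/
lemma eq_zero_of_map_coord_eq_zero [PreservesColimitsOfShape (Discrete ι) K] (x : K.obj (∐ X))
    (hx : ∀ i, K.map (coord X i) x = 0) : x = 0 := by
  obtain ⟨s, hs⟩ := exists_map_trunc_eq X K x
  rw [← hs, map_trunc_elt]
  exact Finset.sum_eq_zero fun i _ => by rw [hx, map_zero]

end Truncation

/-! ### Compact objects -/

section Compact

variable {C : Type u} [Category.{v} C] [Preadditive C]

/-- An object is compact if and only if every morphism from it to a coproduct is supported on
finitely many summands. -/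
lemma compactObjects_iff [HasCoproducts.{v} C] (A : C) :
    compactObjects C A ↔ ∀ (ι : Type v) (X : ι → C) (f : A ⟶ ∐ X), ∃ s, f ≫ trunc X s = f := by
  refine ⟨fun hA ι X f => ?_, fun hA ι => ?_⟩
  · have := hA ι
    exact exists_map_trunc_eq X (preadditiveCoyoneda.obj (op A)) f
  · refine @preservesColimitsOfShape_of_discrete _ _ _ _ _ _ fun X => ?_
    have hcoord {f : A ⟶ ∐ X} {s} (hs : f ≫ trunc X s = f) {i : ι} (hi : i ∉ s) :
        f ≫ coord X i = 0 := by
      rw [← hs, Category.assoc, trunc_coord_of_notMem X hi, comp_zero]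
    refine preservesColimit_of_preserves_colimit_cocone (coproductIsCoproduct X) ?_
    refine (isColimitMapCoconeCofanMkEquiv (preadditiveCoyoneda.obj (op A)) X _).symm ?_
    let k (t : Cofan fun i => (preadditiveCoyoneda.obj (op A)).obj (X i)) (i : ι) :
        (A ⟶ X i) →+ t.pt := (t.inj i).hom
    have hsupp (t : Cofan fun i => (preadditiveCoyoneda.obj (op A)).obj (X i)) {f : A ⟶ ∐ X} {s}
        (hs : f ≫ trunc X s = f) : (Function.support fun i => k t i (f ≫ coord X i)) ⊆ s := by
      intro i hi
      by_contra his
      refine hi ?_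
      dsimp only
      rw [hcoord hs his, map_zero]
    have hfin (t : Cofan fun i => (preadditiveCoyoneda.obj (op A)).obj (X i)) (f : A ⟶ ∐ X) :
        (Function.support fun i => k t i (f ≫ coord X i)).Finite := by
      obtain ⟨s, hs⟩ := hA ι X f
      exact s.finite_toSet.subset (hsupp t hs)
    let d (t : Cofan fun i => (preadditiveCoyoneda.obj (op A)).obj (X i)) : (A ⟶ ∐ X) →+ t.pt :=
      { toFun := fun f => ∑ᶠ i, k t i (f ≫ coord X i)
        map_zero' := by simp
        map_add' := fun f g => by
          rw [← finsum_add_distrib (hfin t f) (hfin t g)]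
          simp }
    refine Cofan.IsColimit.mk _ (fun t => AddCommGrpCat.ofHom (d t)) ?_ ?_
    · intro t j
      ext (f : A ⟶ X j)
      change ∑ᶠ i, k t i ((f ≫ Sigma.ι X j) ≫ coord X i) = k t j f
      rw [finsum_eq_single _ j]
      · rw [Category.assoc, ι_coord_self, Category.comp_id]
      · intro i hi
        rw [Category.assoc, ι_coord_of_ne X hi.symm, comp_zero, map_zero]
    · intro t m hm
      let m' : (A ⟶ ∐ X) →+ t.pt := m.hom
      have hm' (j : ι) (f : A ⟶ X j) : m' (f ≫ Sigma.ι X j) = k t j f :=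
        congrArg (fun φ => φ.hom f) (hm j)
      ext (f : A ⟶ ∐ X)
      change m' f = ∑ᶠ i, k t i (f ≫ coord X i)
      obtain ⟨s, hs⟩ := hA ι X f
      rw [finsum_eq_sum_of_support_subset (s := s) _ (hsupp t hs)]
      conv_lhs => rw [← hs, trunc, Preadditive.comp_sum, map_sum]
      refine Finset.sum_congr rfl fun i _ => ?_
      rw [← hm', Category.assoc]

end Compact

section Triangulated

open scoped ZeroObject

variable {C : Type u} [Category.{v} C]

lemma prop_coproduct_of_isClosedUnder (Q : ObjectProperty C)
    (hQ : ∀ ι : Type v, Q.IsClosedUnderColimitsOfShape (Discrete ι))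
    [HasCoproducts.{v} C] {ι : Type v} (X : ι → C) (hX : ∀ i, Q (X i)) : Q (∐ X) := by
  have := hQ ι
  exact Q.prop_colimit (Discrete.functor X) (fun i => hX i.as)

variable [HasShift C ℤ]

lemma prop_shift_zero_iff (Q : ObjectProperty C) [Q.IsClosedUnderIsomorphisms] (X : C) :
    Q (X⟦(0 : ℤ)⟧) ↔ Q X :=
  Q.prop_iff_of_iso ((shiftFunctorZero C ℤ).app X)

variable [Preadditive C]

instance : (compactObjects C).IsClosedUnderIsomorphisms where
  of_iso e h ι := by
    have := h ι
    exact preservesColimitsOfShape_of_natIso (preadditiveCoyoneda.mapIso e.symm.op)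

lemma compactObjects_shift [HasCoproducts.{v} C] {A : C} (hA : compactObjects C A) (n : ℤ) :
    compactObjects C (A⟦n⟧) := by
  rw [compactObjects_iff]
  intro ι X f
  have : PreservesColimitsOfShape (Discrete ι) (preadditiveCoyoneda.obj (op (A⟦n⟧⟦-n⟧))) :=
    (compactObjects C).prop_of_iso ((shiftFunctorCompIsoId C n (-n) (by simp)).app A).symm hA ι
  obtain ⟨s, hs⟩ := exists_map_trunc_eq X
    (shiftFunctor C (-n) ⋙ preadditiveCoyoneda.obj (op (A⟦n⟧⟦-n⟧))) (f⟦-n⟧')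
  refine ⟨s, (shiftFunctor C (-n)).map_injective ?_⟩
  rw [Functor.map_comp]
  exact hs

variable [HasZeroObject C] [∀ n : ℤ, (shiftFunctor C n).Additive] [Pretriangulated C]
  [HasCoproducts.{v} C]

/-! ### Localising subcategories defined by a condition on all shifts -/

section Devissage

variable (Q : ObjectProperty C)

/-- A condition on objects defines a localising subcategory when it is imposed on all shifts,
and it suffices to check the closure properties for the original condition. -/
lemma isLocalising_forall_shift [Q.IsStableUnderRetracts] (hzero : ∀ X, IsZero X → Q X)
    (hext : ∀ T ∈ distTriang C, (∀ n : ℤ, Q (T.obj₁⟦n⟧)) → (∀ n : ℤ, Q (T.obj₃⟦n⟧)) → Q T.obj₂)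
    (hcoprod : ∀ (ι : Type v) (X : ι → C), (∀ i, ∀ n : ℤ, Q ((X i)⟦n⟧)) → Q (∐ X)) :
    IsLocalising (fun X => ∀ n : ℤ, Q (X⟦n⟧)) := by
  let P : ObjectProperty C := fun X => ∀ n : ℤ, Q (X⟦n⟧)
  have hshift (X : C) (hX : P X) (a : ℤ) : P (X⟦a⟧) := fun b =>
    Q.prop_of_iso ((shiftFunctorAdd C a b).app X) (hX (a + b))
  have hretract : P.IsStableUnderRetracts :=
    ⟨fun h hY n => Q.prop_of_retract (h.map (shiftFunctor C n)) (hY n)⟩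
  have htri : P.IsTriangulated :=
    { exists_zero := ⟨0, isZero_zero C, fun n =>
        hzero _ ((shiftFunctor C n).map_isZero (isZero_zero C))⟩
      isStableUnderShiftBy := fun a => ⟨fun X hX => hshift X hX a⟩
      toIsTriangulatedClosed₂ := .mk' fun T hT h₁ h₃ n =>
        hext _ (Triangle.shift_distinguished T hT n) (hshift _ h₁ n) (hshift _ h₃ n) }
  refine ⟨⟨htri, hretract⟩, fun ι => .mk' ?_⟩
  rintro _ ⟨F, hF⟩ n
  let X : ι → C := fun i => F.obj ⟨i⟩
  have e : (colimit F)⟦n⟧ ≅ ∐ fun i => (X i)⟦n⟧ :=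
    (shiftFunctor C n).mapIso (HasColimit.isoOfNatIso Discrete.natIsoFunctor) ≪≫
      PreservesCoproduct.iso (shiftFunctor C n) X
  exact Q.prop_of_iso e.symm (hcoprod ι _ fun i => hshift _ (hF ⟨i⟩) n)

/-- The principle of dévissage in a compactly generated triangulated category: a condition on
objects holds everywhere if it holds for the shifts of compact objects and, when imposed on all
shifts, is inherited by extensions and coproducts. -/
lemma forall_prop_of_compact (hC : IsCompactlyGeneratedCategory C) [Q.IsStableUnderRetracts]
    (hcompact : ∀ A, compactObjects C A → ∀ n : ℤ, Q (A⟦n⟧))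
    (hext : ∀ T ∈ distTriang C, (∀ n : ℤ, Q (T.obj₁⟦n⟧)) → (∀ n : ℤ, Q (T.obj₃⟦n⟧)) → Q T.obj₂)
    (hcoprod : ∀ (ι : Type v) (X : ι → C), (∀ i, ∀ n : ℤ, Q ((X i)⟦n⟧)) → Q (∐ X))
    (hzero : ∀ X, IsZero X → Q X) (X : C) : Q X := by
  have h := hC.eq_top _ (isLocalising_forall_shift Q hzero hext hcoprod) hcompact
  exact (prop_shift_zero_iff Q X).1 ((show _ = _ from congrFun h X).mpr trivial 0)

end Devissage

/-! ### Compact objects form a triangulated subcategory -/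

instance : (compactObjects C).IsTriangulated where
  exists_zero := by
    refine ⟨0, isZero_zero C, ?_⟩
    rw [compactObjects_iff]
    exact fun ι X f => ⟨∅, (isZero_zero C).eq_of_src _ _⟩
  isStableUnderShiftBy n := ⟨fun A hA => compactObjects_shift hA n⟩
  toIsTriangulatedClosed₂ := .mk' fun T hT h₁ h₃ => by
    classical
    rw [compactObjects_iff] at h₁ h₃ ⊢
    intro ι X f
    obtain ⟨s, hs⟩ := h₁ ι X (T.mor₁ ≫ f)
    obtain ⟨g, hg⟩ := Triangle.yoneda_exact₂ T hT (f - f ≫ trunc X s) (by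
      rw [Preadditive.comp_sub, ← Category.assoc, hs, sub_self])
    obtain ⟨t, ht⟩ := h₃ ι X g
    refine ⟨s ∪ t, ?_⟩
    -- both `f ≫ trunc X s` and the remainder `f - f ≫ trunc X s` are fixed by `trunc X (s ∪ t)`
    have e₁ : (f ≫ trunc X s) ≫ trunc X (s ∪ t) = f ≫ trunc X s := by
      rw [Category.assoc, trunc_comp_of_subset X Finset.subset_union_left]
    have e₂ : (f - f ≫ trunc X s) ≫ trunc X (s ∪ t) = f - f ≫ trunc X s := by
      rw [hg, ← ht, Category.assoc, Category.assoc,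
        trunc_comp_of_subset X Finset.subset_union_right]
    rw [Preadditive.sub_comp, e₁, sub_left_inj] at e₂
    exact e₂

lemma compactObjects_biprod {A B : C} (hA : compactObjects C A) (hB : compactObjects C B) :
    compactObjects C (A ⊞ B) :=
  (compactObjects C).ext_of_isTriangulatedClosed₂ _
    (binaryBiproductTriangle_distinguished A B) hA hB

end Triangulated

section Homology

open scoped ZeroObject

variable {C : Type u} [Category.{v} C] [HasZeroObject C] [HasShift C ℤ] [Preadditive C]
  [∀ n : ℤ, (shiftFunctor C n).Additive] [Pretriangulated C] (K : C ⥤ AddCommGrpCat.{v})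

/-! ### Homology theories are determined by compact objects -/

section Exact

variable [K.IsHomological]

lemma exists_of_map_mor₂_eq_zero {T : Triangle C} (hT : T ∈ distTriang C) {x : K.obj T.obj₂}
    (hx : K.map T.mor₂ x = 0) : ∃ y, K.map T.mor₁ y = x :=
  (ShortComplex.ab_exact_iff _).1 (K.map_distinguished_exact T hT) x hx

lemma exists_of_map_shift_mor₂_eq_zero {T : Triangle C} (hT : T ∈ distTriang C) (n : ℤ)
    {x : K.obj (T.obj₂⟦n⟧)} (hx : K.map (T.mor₂⟦n⟧') x = 0) : ∃ y, K.map (T.mor₁⟦n⟧') y = x := by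
  let := Functor.ShiftSequence.tautological K ℤ
  exact (ShortComplex.ab_exact_iff _).1 (K.homologySequence_exact₂ T hT n) x hx

/-- The boundary morphism of a distinguished triangle from the desuspension of its third object
to its first object. -/
lemma exists_connecting {T : Triangle C} (hT : T ∈ distTriang C) :
    ∃ e : T.obj₃⟦(-1 : ℤ)⟧ ⟶ T.obj₁, e ≫ T.mor₁ = 0 ∧
      ∀ x : K.obj T.obj₁, K.map T.mor₁ x = 0 → ∃ y, K.map e y = x :=
  ⟨T.invRotate.mor₁, comp_distTriang_mor_zero₁₂ _ (inv_rot_of_distTriang T hT),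
    fun _ hx => exists_of_map_mor₂_eq_zero K (inv_rot_of_distTriang T hT) hx⟩

end Exact

/-- Objects `X` on which `K` is determined by compact objects: every element of `K.obj X` is
the image of an element under a morphism from a compact object, and if such an element dies
in `K.obj X` then it already comes from a compact object mapping trivially to `X`. -/
def compactlySupported : ObjectProperty C := fun X =>
  (∀ x : K.obj X, ∃ (A : C) (_ : compactObjects C A) (f : A ⟶ X) (a : K.obj A), K.map f a = x) ∧
  ∀ (A : C) (_ : compactObjects C A) (f : A ⟶ X) (a : K.obj A), K.map f a = 0 →
    ∃ (B : C) (_ : compactObjects C B) (g : B ⟶ A) (b : K.obj B), K.map g b = a ∧ g ≫ f = 0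

instance : (compactlySupported K).IsStableUnderRetracts where
  of_retract {X Y} h := by
    rintro ⟨h₁, h₂⟩
    refine ⟨fun x => ?_, fun A hA f a hf => ?_⟩
    · obtain ⟨A, hA, f, a, hf⟩ := h₁ (K.map h.i x)
      exact ⟨A, hA, f ≫ h.r, a, by rw [map_comp_elt, hf, ← map_comp_elt, h.retract, map_id_elt]⟩
    · obtain ⟨B, hB, g, b, hb, hg⟩ := h₂ A hA (f ≫ h.i) a (by rw [map_comp_elt, hf, map_zero])
      refine ⟨B, hB, g, b, hb, ?_⟩
      have := congrArg (· ≫ h.r) hg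
      simpa using this

variable {K} [HasCoproducts.{v} C]

lemma exists_biprod_support {X A B : C} (hA : compactObjects C A) (hB : compactObjects C B)
    (f : A ⟶ X) (g : B ⟶ X) (a : K.obj A) (b : K.obj B) :
    ∃ (D : C) (_ : compactObjects C D) (h : D ⟶ X) (d : K.obj D),
      K.map h d = K.map f a + K.map g b := by
  refine ⟨A ⊞ B, compactObjects_biprod hA hB, biprod.desc f g,
    K.map biprod.inl a + K.map biprod.inr b, ?_⟩
  rw [map_add, ← map_comp_elt, ← map_comp_elt, biprod.inl_desc, biprod.inr_desc]

variable [K.IsHomological]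

/-- An element dying under a morphism of compact objects comes from the fibre, which is
compact. -/
lemma compactlySupported_of_isCompact {X : C} (hX : compactObjects C X) :
    compactlySupported K X := by
  refine ⟨fun x => ⟨X, hX, 𝟙 X, x, map_id_elt K x⟩, fun A hA f a hf => ?_⟩
  obtain ⟨F, hF, g, _, hT⟩ := (compactObjects C).distinguished_cocone_triangle₁ f hA hX
  obtain ⟨b, hb⟩ := exists_of_map_mor₂_eq_zero K hT hf
  exact ⟨F, hF, g, b, hb, comp_distTriang_mor_zero₁₂ _ hT⟩

lemma compactlySupported_coproduct {ι : Type v} [PreservesColimitsOfShape (Discrete ι) K]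
    (X : ι → C) (hX : ∀ i, compactlySupported K (X i)) : compactlySupported K (∐ X) := by
  classical
  refine ⟨fun x => ?_, fun A hA f a hf => ?_⟩
  · obtain ⟨s, hs⟩ := exists_map_trunc_eq X K x
    rw [← hs, map_trunc_elt]
    clear hs
    induction s using Finset.induction_on with
    | empty => exact ⟨0, (compactObjects C).prop_zero, 0, 0, by simp⟩
    | insert i s hi ih =>
      obtain ⟨B, hB, g, b, hb⟩ := ih
      obtain ⟨D, hD, h, d, hd⟩ := (hX i).1 (K.map (coord X i) x)
      rw [Finset.sum_insert hi, ← hb, ← hd, ← map_comp_elt]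
      exact exists_biprod_support hD hB _ _ _ _
  · have := hA ι
    obtain ⟨s, hs⟩ := exists_map_trunc_eq X (preadditiveCoyoneda.obj (op A)) f
    replace hs : f ≫ trunc X s = f := hs
    -- the finitely many nonzero coordinates of `f` are killed one after the other
    suffices ∃ (B : C) (_ : compactObjects C B) (g : B ⟶ A) (b : K.obj B),
        K.map g b = a ∧ g ≫ f ≫ trunc X s = 0 by rwa [hs] at this
    clear hs
    induction s using Finset.induction_on with
    | empty => exact ⟨A, hA, 𝟙 A, a, map_id_elt K a, by simp [trunc]⟩
    | insert i s hi ih =>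
      obtain ⟨B, hB, g, b, hb, hg⟩ := ih
      obtain ⟨D, hD, h, d, hd, hh⟩ := (hX i).2 B hB (g ≫ f ≫ coord X i) b (by
        rw [map_comp_elt, map_comp_elt, hb, hf, map_zero])
      refine ⟨D, hD, h ≫ g, d, by rw [map_comp_elt, hd, hb], ?_⟩
      rw [trunc, Finset.sum_insert hi, ← trunc, Preadditive.comp_add, Preadditive.comp_add,
        Category.assoc, Category.assoc, hg, comp_zero, add_zero]
      rw [← Category.assoc f, ← Category.assoc g, ← Category.assoc h, hh, zero_comp]

lemma compactlySupported_obj₂ {T : Triangle C} (hT : T ∈ distTriang C)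
    (h₁ : compactlySupported K T.obj₁) (h₁' : compactlySupported K (T.obj₁⟦(1 : ℤ)⟧))
    (h₃ : compactlySupported K T.obj₃) (h₃' : compactlySupported K (T.obj₃⟦(-1 : ℤ)⟧)) :
    compactlySupported K T.obj₂ := by
  refine ⟨fun x => ?_, fun A hA f a hf => ?_⟩
  · obtain ⟨A, hA, f, a, hf⟩ := h₃.1 (K.map T.mor₂ x)
    obtain ⟨B, hB, g, b, hb, hg⟩ := h₁'.2 A hA (f ≫ T.mor₃) a (by
      rw [map_comp_elt, hf, ← map_comp_elt, comp_distTriang_mor_zero₂₃ _ hT, map_zero_elt])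
    obtain ⟨k, hk⟩ := Triangle.coyoneda_exact₃ T hT (g ≫ f) (by rw [Category.assoc, hg])
    -- `x` and the image of `b` agree in `K.obj T.obj₃`, so they differ by an element coming
    -- from `K.obj T.obj₁`
    obtain ⟨y, hy⟩ := exists_of_map_mor₂_eq_zero K hT (x := x - K.map k b) (by
      rw [map_sub, ← map_comp_elt, ← hk, map_comp_elt, hb, hf, sub_self])
    obtain ⟨D, hD, h, d, hd⟩ := h₁.1 y
    obtain ⟨E, hE, l, e, he⟩ := exists_biprod_support hD hB (h ≫ T.mor₁) k d b
    refine ⟨E, hE, l, e, ?_⟩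
    rw [he, map_comp_elt, hd, hy, sub_add_cancel]
  · obtain ⟨B, hB, g, b, hb, hg⟩ := h₃.2 A hA (f ≫ T.mor₂) a (by
      rw [map_comp_elt, hf, map_zero])
    obtain ⟨h, hh⟩ := Triangle.coyoneda_exact₂ T hT (g ≫ f) (by rw [Category.assoc, hg])
    -- the image of `b` in `K.obj T.obj₁` dies in `K.obj T.obj₂`, so it comes from the
    -- desuspension of `T.obj₃`
    obtain ⟨c, hc, hc'⟩ := exists_connecting K hT
    obtain ⟨y, hy⟩ := hc' (K.map h b) (by rw [← map_comp_elt, ← hh, map_comp_elt, hb, hf])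
    obtain ⟨D, hD, k, d, hd⟩ := h₃'.1 y
    obtain ⟨E, hE, l, e, he, hl⟩ := h₁.2 (B ⊞ D) (compactObjects_biprod hB hD)
      (biprod.desc h (-(k ≫ c))) (K.map biprod.inl b + K.map biprod.inr d) (by
        rw [map_add, ← map_comp_elt, ← map_comp_elt, biprod.inl_desc, biprod.inr_desc,
          map_neg_elt, map_comp_elt, hd, hy, add_neg_cancel])
    refine ⟨E, hE, l ≫ biprod.fst ≫ g, e, ?_, ?_⟩
    · rw [map_comp_elt, he, map_comp_elt, map_add, ← map_comp_elt, ← map_comp_elt,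
        biprod.inl_fst, biprod.inr_fst, map_id_elt, map_zero_elt, add_zero, hb]
    · have h0 : (biprod.fst ≫ g) ≫ f = biprod.desc h (-(k ≫ c)) ≫ T.mor₁ := by
        ext
        · simp [hh]
        · simp [hc]
      rw [Category.assoc, h0, ← Category.assoc, hl, zero_comp]

theorem compactlySupported_all (hC : IsCompactlyGeneratedCategory C) (hK : IsHomologyTheory K)
    (X : C) : compactlySupported K X := by
  refine forall_prop_of_compact (compactlySupported K) hC
    (fun A hA n => compactlySupported_of_isCompact (compactObjects_shift hA n))
    (fun T hT h₁ h₃ => compactlySupported_obj₂ hT ((prop_shift_zero_iff _ _).1 (h₁ 0)) (h₁ 1)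
      ((prop_shift_zero_iff _ _).1 (h₃ 0)) (h₃ (-1)))
    (fun ι Y hY => ?_) (fun Y hY => ?_) X
  · have := hK.preservesCoproducts ι
    exact compactlySupported_coproduct Y fun i => (prop_shift_zero_iff _ _).1 (hY i 0)
  · exact compactlySupported_of_isCompact ((compactObjects C).prop_of_isZero hY)

/-- The kernel of a homology theory is localising. -/
theorem isLocalising_homologicalKernel (hK : IsHomologyTheory K) :
    IsLocalising K.homologicalKernel := by
  let Q : ObjectProperty C := fun X => IsZero (K.obj X)
  have : Q.IsStableUnderRetracts := ⟨fun {X Y} h hY => by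
    refine isZero_of_forall_eq_zero fun x => ?_
    rw [← map_id_elt K x, ← h.retract, map_comp_elt, eq_zero_of_isZero hY (K.map h.i x), map_zero]⟩
  refine isLocalising_forall_shift Q (fun X hX => K.map_isZero hX) (fun T hT h₁ h₃ => ?_)
    (fun ι X hX => ?_)
  · refine isZero_of_forall_eq_zero fun x => ?_
    obtain ⟨y, rfl⟩ := exists_of_map_mor₂_eq_zero K hT (x := x)
      (eq_zero_of_isZero ((prop_shift_zero_iff Q _).1 (h₃ 0)) _)
    rw [eq_zero_of_isZero ((prop_shift_zero_iff Q _).1 (h₁ 0)) y, map_zero]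
  · have := hK.preservesCoproducts ι
    refine isZero_of_forall_eq_zero fun x => eq_zero_of_map_coord_eq_zero X K x fun i => ?_
    exact eq_zero_of_isZero ((prop_shift_zero_iff Q _).1 (hX i 0)) _

end Homology

/-! ### Cohomological functors -/

section Pull

variable {C : Type u} [Category.{v} C] (H : Cᵒᵖ ⥤ AddCommGrpCat.{w})

/-- The restriction of an element of a contravariant functor along a morphism. -/
def pull {X Y : C} (f : X ⟶ Y) (y : H.obj (op Y)) : H.obj (op X) := H.map f.op y

lemma pull_id {X : C} (x : H.obj (op X)) : pull H (𝟙 X) x = x := by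
  simp [pull]

lemma pull_comp {X Y Z : C} (f : X ⟶ Y) (g : Y ⟶ Z) (z : H.obj (op Z)) :
    pull H (f ≫ g) z = pull H f (pull H g z) := by
  simp [pull]

lemma pull_zero_right {X Y : C} (f : X ⟶ Y) : pull H f 0 = 0 := map_zero _

lemma pull_sub_right {X Y : C} (f : X ⟶ Y) (x y : H.obj (op Y)) :
    pull H f (x - y) = pull H f x - pull H f y := map_sub _ _ _

variable [Preadditive C] [H.Additive]

lemma pull_add {X Y : C} (f g : X ⟶ Y) (y : H.obj (op Y)) :
    pull H (f + g) y = pull H f y + pull H g y :=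
  map_add_elt H f.op g.op y

lemma pull_sub {X Y : C} (f g : X ⟶ Y) (y : H.obj (op Y)) :
    pull H (f - g) y = pull H f y - pull H g y :=
  map_sub_elt H f.op g.op y

lemma pull_zero {X Y : C} (y : H.obj (op Y)) : pull H (0 : X ⟶ Y) y = 0 :=
  map_zero_elt H (X := op Y) (Y := op X) y

end Pull

section Telescope

variable {C : Type u} [Category.{v} C]

/-- A functor preserving all small coproducts preserves countable ones. -/
lemma preservesColimitsOfShape_nat (K : C ⥤ AddCommGrpCat.{v})
    (hK : ∀ ι : Type v, PreservesColimitsOfShape (Discrete ι) K) :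
    PreservesColimitsOfShape (Discrete ℕ) K := by
  have := hK (ULift ℕ)
  exact preservesColimitsOfShape_of_equiv (Discrete.equivalence Equiv.ulift) K

variable [HasCoproducts.{v} C]

/-- The natural numbers may live in a smaller universe than the index types of the available
coproducts. -/
lemma hasCoproduct_of_nat (X : ℕ → C) : HasCoproduct X :=
  have : HasColimitsOfShape (Discrete (ULift.{v} ℕ)) C := inferInstance
  have := hasColimitsOfShape_of_equivalence (C := C)
    (Discrete.equivalence (Equiv.ulift : ULift.{v} ℕ ≃ ℕ))
  inferInstance

attribute [local instance] hasCoproduct_of_nat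

/-- The endomorphism of the coproduct of a sequence induced by its transition morphisms. -/
noncomputable def succMap (X : ℕ → C) (s : ∀ n, X n ⟶ X (n + 1)) : ∐ X ⟶ ∐ X :=
  Sigma.desc fun n => s n ≫ Sigma.ι X (n + 1)

@[simp]
lemma ι_succMap (X : ℕ → C) (s : ∀ n, X n ⟶ X (n + 1)) (n : ℕ) :
    Sigma.ι X n ≫ succMap X s = s n ≫ Sigma.ι X (n + 1) := by
  simp [succMap]

variable [HasZeroObject C] [HasShift C ℤ] [Preadditive C]
  [∀ n : ℤ, (shiftFunctor C n).Additive] [Pretriangulated C]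

/-- A contravariant functor is cohomological if it is additive, sends distinguished triangles to
exact sequences, and sends all small coproducts to products. -/
structure IsCohomological (H : Cᵒᵖ ⥤ AddCommGrpCat.{w}) : Prop where
  additive : H.Additive
  exact : ∀ T ∈ distTriang C, ∀ x : H.obj (op T.obj₂), pull H T.mor₁ x = 0 →
    ∃ y, pull H T.mor₂ y = x
  existsUnique : ∀ (ι : Type v) (X : ι → C) (x : ∀ i, H.obj (op (X i))),
    ∃! y : H.obj (op (∐ X)), ∀ i, pull H (Sigma.ι X i) y = x i

section

variable {H : Cᵒᵖ ⥤ AddCommGrpCat.{w}} (hH : IsCohomological H)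
include hH

lemma IsCohomological.eq_zero {ι : Type v} {X : ι → C} {y : H.obj (op (∐ X))}
    (hy : ∀ i, pull H (Sigma.ι X i) y = 0) : y = 0 :=
  (hH.existsUnique ι X fun _ => 0).unique hy fun _ => pull_zero_right H _

/-- Cohomological functors also send countable coproducts to products. -/
lemma IsCohomological.existsUnique_nat (X : ℕ → C) (x : ∀ n, H.obj (op (X n))) :
    ∃! y : H.obj (op (∐ X)), ∀ n, pull H (Sigma.ι X n) y = x n := by
  let e : ∐ (fun i : ULift.{v} ℕ => X i.down) ≅ ∐ X :=
    { hom := Sigma.desc fun i => Sigma.ι X i.down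
      inv := Sigma.desc fun n => Sigma.ι (fun i : ULift.{v} ℕ => X i.down) ⟨n⟩ }
  obtain ⟨y, hy, hy'⟩ := hH.existsUnique (ULift ℕ) (fun i => X i.down) fun i => x i.down
  refine ⟨pull H e.inv y, fun n => ?_, fun z hz => ?_⟩
  · rw [← pull_comp]
    have : Sigma.ι X n ≫ e.inv = Sigma.ι (fun i : ULift.{v} ℕ => X i.down) ⟨n⟩ := by simp [e]
    rw [this, hy]
  · rw [← hy' (pull H e.hom z), ← pull_comp, e.inv_hom_id, pull_id]
    intro i
    have : Sigma.ι (fun i : ULift.{v} ℕ => X i.down) i ≫ e.hom = Sigma.ι X i.down := by simp [e]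
    rw [← pull_comp, this, hz]

end

lemma isCohomological_preadditiveYoneda (V : C) : IsCohomological (preadditiveYoneda.obj V) where
  additive := inferInstance
  exact T hT x hx := by
    obtain ⟨y, hy⟩ := Triangle.yoneda_exact₂ T hT x hx
    exact ⟨y, hy.symm⟩
  existsUnique ι X x :=
    ⟨(Sigma.desc x : ∐ X ⟶ V), fun i => Sigma.ι_desc x i,
      fun (y : ∐ X ⟶ V) hy => Sigma.hom_ext _ _ fun i => (hy i).trans (Sigma.ι_desc x i).symm⟩

/-! ### Homotopy colimits of sequences -/

section Hocolim

variable (X : ℕ → C) (s : ∀ n, X n ⟶ X (n + 1))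

lemma exists_hocolim : ∃ (L : C) (p : ∐ X ⟶ L) (d : L ⟶ (∐ X)⟦(1 : ℤ)⟧),
    Triangle.mk (𝟙 _ - succMap X s) p d ∈ distTriang C :=
  distinguished_cocone_triangle _

/-- The homotopy colimit of a sequence: the cone of the difference of the identity and of the
transition morphisms on the coproduct of its terms. -/
noncomputable def hocolim : C := (exists_hocolim X s).choose

/-- The canonical morphism from the coproduct of the terms to the homotopy colimit. -/
noncomputable def hocolimπ : ∐ X ⟶ hocolim X s := (exists_hocolim X s).choose_spec.choose

/-- The morphism from a term of a sequence to its homotopy colimit. -/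
noncomputable def hocolimι (n : ℕ) : X n ⟶ hocolim X s := Sigma.ι X n ≫ hocolimπ X s

lemma hocolim_distinguished :
    ∃ d, Triangle.mk (𝟙 _ - succMap X s) (hocolimπ X s) d ∈ distTriang C :=
  (exists_hocolim X s).choose_spec.choose_spec

lemma comp_hocolimι (n : ℕ) : s n ≫ hocolimι X s (n + 1) = hocolimι X s n := by
  obtain ⟨d, hd⟩ := hocolim_distinguished X s
  have h : (𝟙 _ - succMap X s) ≫ hocolimπ X s = 0 := comp_distTriang_mor_zero₁₂ _ hd
  have := congrArg (fun f => Sigma.ι X n ≫ f) h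
  simp only [Preadditive.sub_comp, Category.id_comp, Preadditive.comp_sub, comp_zero,
    reassoc_of% (ι_succMap X s n), sub_eq_zero] at this
  exact this.symm

lemma exists_comp_hocolimι_eq {n m : ℕ} (h : n ≤ m) :
    ∃ t : X n ⟶ X m, t ≫ hocolimι X s m = hocolimι X s n := by
  induction m, h using Nat.le_induction with
  | base => exact ⟨𝟙 _, Category.id_comp _⟩
  | succ m _ ih =>
    obtain ⟨t, ht⟩ := ih
    exact ⟨t ≫ s m, by rw [Category.assoc, comp_hocolimι, ht]⟩

/-- A morphism from a compact object to a homotopy colimit factors through a term of the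
sequence. -/
lemma exists_factor_hocolimι {A : C} (hA : compactObjects C A) (f : A ⟶ hocolim X s) :
    ∃ (n : ℕ) (g : A ⟶ X n), g ≫ hocolimι X s n = f := by
  obtain ⟨d, hd⟩ := hocolim_distinguished X s
  have := preservesColimitsOfShape_nat (preadditiveCoyoneda.obj (op A)) hA
  have hfd : f ≫ d = 0 := by
    -- the endomorphism `1 - succMap X s` is injective on morphisms from compact objects
    have h0 : (f ≫ d) ≫ (𝟙 _ - succMap X s)⟦(1 : ℤ)⟧' = 0 := by
      rw [Category.assoc]
      exact (congrArg (f ≫ ·) (comp_distTriang_mor_zero₃₁ _ hd)).trans comp_zero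
    rw [CategoryTheory.Functor.map_sub, CategoryTheory.Functor.map_id, Preadditive.comp_sub,
      Category.comp_id, sub_eq_zero] at h0
    refine eq_zero_of_map_coord_eq_zero X (shiftFunctor C (1 : ℤ) ⋙ preadditiveCoyoneda.obj (op A))
      (f ≫ d) fun n => ?_
    change (f ≫ d) ≫ (coord X n)⟦(1 : ℤ)⟧' = 0
    induction n with
    | zero =>
      have : succMap X s ≫ coord X 0 = 0 := Sigma.hom_ext _ _ fun n => by
        rw [reassoc_of% (ι_succMap X s n), ι_coord_of_ne X (Nat.succ_ne_zero n), comp_zero,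
          comp_zero]
      rw [h0, Category.assoc, ← Functor.map_comp, this, Functor.map_zero, comp_zero]
    | succ n ih =>
      have : succMap X s ≫ coord X (n + 1) = coord X n ≫ s n := Sigma.hom_ext _ _ fun m => by
        rw [reassoc_of% (ι_succMap X s m)]
        by_cases h : m = n
        · subst h
          rw [ι_coord_self, reassoc_of% (ι_coord_self X m), Category.comp_id]
        · rw [ι_coord_of_ne X (by lia), reassoc_of% (ι_coord_of_ne X h), comp_zero, zero_comp]
      rw [h0, Category.assoc, ← Functor.map_comp, this, Functor.map_comp, ← Category.assoc, ih,
        zero_comp]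
  obtain ⟨g, rfl⟩ : ∃ g : A ⟶ ∐ X, f = g ≫ hocolimπ X s := Triangle.coyoneda_exact₃ _ hd f hfd
  obtain ⟨t, ht⟩ : ∃ t, g ≫ trunc X t = g :=
    exists_map_trunc_eq X (preadditiveCoyoneda.obj (op A)) g
  have hle (i : ℕ) (hi : i ∈ t) :
      ∃ k : X i ⟶ X (t.sup id), k ≫ hocolimι X s (t.sup id) = hocolimι X s i :=
    exists_comp_hocolimι_eq X s (Finset.le_sup (f := id) hi)
  choose k hk using hle
  refine ⟨t.sup id, ∑ i ∈ t.attach, g ≫ coord X i ≫ k i.1 i.2, ?_⟩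
  conv_rhs => rw [← ht]
  rw [trunc, Preadditive.comp_sum, Preadditive.sum_comp, Preadditive.sum_comp,
    ← Finset.sum_attach t]
  refine Finset.sum_congr rfl fun i _ => ?_
  simp only [Category.assoc]
  rw [hk, hocolimι]

/-- If all the transition morphisms of a sequence are killed by a homology theory in all degrees,
then so is the homotopy colimit, since the identity minus the transition morphisms becomes
invertible. -/
lemma hocolim_mem_homologicalKernel {K : C ⥤ AddCommGrpCat.{v}} (hK : IsHomologyTheory K)
    (hs : ∀ n (m : ℤ), K.map ((s n)⟦m⟧') = 0) : K.homologicalKernel (hocolim X s) := by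
  obtain ⟨d, hd⟩ := hocolim_distinguished X s
  have := hK.isHomological
  have := preservesColimitsOfShape_nat K hK.preservesCoproducts
  let := Functor.ShiftSequence.tautological K ℤ
  refine (K.homologicalKernel.trW_iff_of_distinguished _ hd).1
    ((K.mem_homologicalKernel_trW_iff _).2 fun m => ?_)
  have h : K.map ((succMap X s)⟦m⟧') = 0 := by
    refine (isColimitOfPreserves (shiftFunctor C m ⋙ K) (coproductIsCoproduct X)).hom_ext
      fun ⟨n⟩ => ?_
    change K.map ((Sigma.ι X n)⟦m⟧') ≫ K.map ((succMap X s)⟦m⟧') = K.map ((Sigma.ι X n)⟦m⟧') ≫ 0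
    rw [← K.map_comp, ← Functor.map_comp, ι_succMap, Functor.map_comp, K.map_comp, hs, zero_comp,
      comp_zero]
  have h' : K.map ((𝟙 (∐ X) - succMap X s)⟦m⟧') = 𝟙 _ := by
    rw [CategoryTheory.Functor.map_sub, K.map_sub, h, sub_zero,
      CategoryTheory.Functor.map_id, K.map_id]
  exact h' ▸ (inferInstance : IsIso (𝟙 _))

end Hocolim

end Telescope

attribute [local instance] hasCoproduct_of_nat

section Cells

variable {C : Type u} [Category.{v} C] [HasCoproducts.{v} C] [HasZeroObject C] [HasShift C ℤ]
  [Preadditive C] [∀ n : ℤ, (shiftFunctor C n).Additive] [Pretriangulated C]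

/-! ### Attaching cells -/

section Attach

variable {ι : Type v} (g : ι → C)

lemma exists_attach (Y : C) (D : Set (Σ i, g i ⟶ Y)) :
    ∃ (E : C) (j : Y ⟶ E) (d : E ⟶ (∐ fun d : D => g d.1.1)⟦(1 : ℤ)⟧),
      Triangle.mk (Sigma.desc fun d : D => d.1.2) j d ∈ distTriang C :=
  distinguished_cocone_triangle _

/-- The object obtained from `Y` by attaching one cell along each morphism of the set `D` of
morphisms from members of the family `g` to `Y`. -/
noncomputable def attach (Y : C) (D : Set (Σ i, g i ⟶ Y)) : C := (exists_attach g Y D).choose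

/-- The canonical morphism to the object obtained by attaching cells. -/
noncomputable def attachι (Y : C) (D : Set (Σ i, g i ⟶ Y)) : Y ⟶ attach g Y D :=
  (exists_attach g Y D).choose_spec.choose

lemma attach_distinguished (Y : C) (D : Set (Σ i, g i ⟶ Y)) :
    ∃ d, Triangle.mk (Sigma.desc fun d : D => d.1.2) (attachι g Y D) d ∈ distTriang C :=
  (exists_attach g Y D).choose_spec.choose_spec

lemma comp_attachι {Y : C} {D : Set (Σ i, g i ⟶ Y)} {d : Σ i, g i ⟶ Y} (hd : d ∈ D) :
    d.2 ≫ attachι g Y D = 0 := by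
  obtain ⟨δ, hδ⟩ := attach_distinguished g Y D
  have h : (Sigma.desc fun d : D => d.1.2) ≫ attachι g Y D = 0 := comp_distTriang_mor_zero₁₂ _ hδ
  rw [← Sigma.ι_desc (fun d : D => d.1.2) ⟨d, hd⟩, Category.assoc, h, comp_zero]

/-- The objects obtained from `X` by attaching cells `n` times; they form a small set. -/
def cellObjects (X : C) : ℕ → Set C
  | 0 => {X}
  | n + 1 => ⋃ Y ∈ cellObjects X n, Set.range (attach g Y)

instance small_cellObjects (X : C) (n : ℕ) : Small.{v} (cellObjects g X n) := by
  induction n with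
  | zero => exact small_single X
  | succ n ih => exact small_biUnion (cellObjects g X n) (fun Y _ => Set.range (attach g Y))

variable {H : Cᵒᵖ ⥤ AddCommGrpCat.{w}} (hH : IsCohomological H)
include hH

lemma IsCohomological.exists_pull_attachι {Y : C} (D : Set (Σ i, g i ⟶ Y)) (y : H.obj (op Y))
    (hD : ∀ d ∈ D, pull H d.2 y = 0) : ∃ z, pull H (attachι g Y D) z = y := by
  obtain ⟨δ, hδ⟩ := attach_distinguished g Y D
  refine hH.exact _ hδ y (hH.eq_zero fun d => ?_)
  change pull H (Sigma.ι (fun d : D => g d.1.1) d) (pull H (Sigma.desc fun d : D => d.1.2) y) = 0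
  rw [← pull_comp, Sigma.ι_desc]
  exact hD _ d.2

lemma IsCohomological.exists_pull_hocolimι (Y : ℕ → C) (s : ∀ n, Y n ⟶ Y (n + 1))
    (y : ∀ n, H.obj (op (Y n))) (hy : ∀ n, pull H (s n) (y (n + 1)) = y n) :
    ∃ ξ, ∀ n, pull H (hocolimι Y s n) ξ = y n := by
  have := hH.additive
  obtain ⟨z, hz, -⟩ := hH.existsUnique_nat Y y
  obtain ⟨δ, hδ⟩ := hocolim_distinguished Y s
  obtain ⟨ξ, hξ⟩ : ∃ ξ, pull H (hocolimπ Y s) ξ = z := by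
    refine hH.exact _ hδ z ((hH.existsUnique_nat Y fun _ => 0).unique (fun n => ?_)
      fun n => pull_zero_right H _)
    change pull H (Sigma.ι Y n) (pull H (𝟙 _ - succMap Y s) z) = 0
    rw [pull_sub, pull_id, pull_sub_right, ← pull_comp, ι_succMap, pull_comp, hz, hz, hy, sub_self]
  exact ⟨ξ, fun n => by rw [hocolimι, pull_comp, hξ, hz]⟩

/-- The basic construction: starting with an element `x` of `H` on `X`, attach cells along all
morphisms from compact objects that kill the element, extend the element, and iterate. The
element extends to the homotopy colimit, and every morphism from a compact object to a term of the
sequence which kills the element dies in the next term. -/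
lemma IsCohomological.exists_telescope
    (hg : ∀ A, compactObjects C A → ∃ i, Nonempty (A ≅ g i)) (X : C) (x : H.obj (op X)) :
    ∃ (Y : ℕ → C) (s : ∀ n, Y n ⟶ Y (n + 1)) (e : X ⟶ Y 0) (ξ : H.obj (op (hocolim Y s))),
      (∀ n, Y n ∈ cellObjects g X n) ∧ pull H (e ≫ hocolimι Y s 0) ξ = x ∧
      ∀ n A, compactObjects C A → ∀ f : A ⟶ Y n,
        pull H (f ≫ hocolimι Y s n) ξ = 0 → f ≫ s n = 0 := by
  -- the cells attached to `p.1` are all those along which the element `p.2` restricts to zero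
  let D (p : Σ Y : C, H.obj (op Y)) : Set (Σ i, g i ⟶ p.1) := {d | pull H d.2 p.2 = 0}
  have hD (p : Σ Y : C, H.obj (op Y)) := hH.exists_pull_attachι g (D p) p.2 fun d hd => hd
  choose z hz using hD
  let p (n : ℕ) : Σ Y : C, H.obj (op Y) :=
    Nat.rec ⟨X, x⟩ (fun _ p => ⟨attach g p.1 (D p), z p⟩) n
  let Y (n : ℕ) : C := (p n).1
  let s (n : ℕ) : Y n ⟶ Y (n + 1) := attachι g (p n).1 (D (p n))
  obtain ⟨ξ, hξ⟩ := hH.exists_pull_hocolimι Y s (fun n => (p n).2) fun n => hz (p n)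
  refine ⟨Y, s, 𝟙 X, ξ, fun n => ?_, ?_, fun n A hA f hf => ?_⟩
  · induction n with
    | zero => exact rfl
    | succ n ih => exact Set.mem_biUnion ih ⟨D (p n), rfl⟩
  · rw [Category.id_comp, hξ]
    rfl
  · obtain ⟨i, ⟨e⟩⟩ := hg A hA
    have hd : (⟨i, e.inv ≫ f⟩ : Σ i, g i ⟶ Y n) ∈ D (p n) := by
      change pull H (e.inv ≫ f) (p n).2 = 0
      rw [← hξ, ← pull_comp, Category.assoc, pull_comp, hf, pull_zero_right]
    have h0 : (e.inv ≫ f) ≫ s n = 0 := comp_attachι g hd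
    rw [← cancel_epi e.inv, comp_zero, ← Category.assoc, h0]

end Attach

omit [HasCoproducts.{v} C] in
lemma exists_compact_family (hC : IsCompactlyGeneratedCategory C) :
    ∃ (ι : Type v) (g : ι → C), (∀ i, compactObjects C (g i)) ∧
      ∀ A, compactObjects C A → ∃ i, Nonempty (A ≅ g i) := by
  have := hC.essentiallySmall
  obtain ⟨P, _, hP, hP'⟩ := ObjectProperty.EssentiallySmall.exists_small_le (compactObjects C)
  refine ⟨Shrink (Subtype P), fun i => ((equivShrink (Subtype P)).symm i).1,
    fun i => hP _ ((equivShrink (Subtype P)).symm i).2, fun A hA => ?_⟩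
  obtain ⟨B, hB, ⟨e⟩⟩ := hP' A hA
  refine ⟨equivShrink _ ⟨B, hB⟩, ⟨?_⟩⟩
  simpa using e

/-! ### Weakly initial sets for the kernel of a homology theory -/

/-- Every morphism from `X` to an object `V` of `ker K` factors through the homotopy colimit in
`ker K` of a sequence of objects obtained from `X` by attaching cells. -/
theorem exists_factor_homologicalKernel (hC : IsCompactlyGeneratedCategory C)
    {K : C ⥤ AddCommGrpCat.{v}} (hK : IsHomologyTheory K)
    {ι : Type v} (g : ι → C) (hg : ∀ A, compactObjects C A → ∃ i, Nonempty (A ≅ g i))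
    {X V : C} (hV : K.homologicalKernel V) (f : X ⟶ V) :
    ∃ (Y : ℕ → C) (s : ∀ n, Y n ⟶ Y (n + 1)) (p : X ⟶ hocolim Y s) (q : hocolim Y s ⟶ V),
      (∀ n, Y n ∈ cellObjects g X n) ∧ p ≫ q = f ∧ K.homologicalKernel (hocolim Y s) := by
  have := hK.isHomological
  obtain ⟨Y, s, e, (ξ : hocolim Y s ⟶ V), hY, hξ, hs⟩ :=
    (isCohomological_preadditiveYoneda V).exists_telescope g hg X f
  refine ⟨Y, s, e ≫ hocolimι Y s 0, ξ, hY, hξ, hocolim_mem_homologicalKernel Y s hK fun n m => ?_⟩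
  ext x
  -- as `V` is in the kernel, `x` comes from the fibre of `Y n ⟶ V`, where it is supported on a
  -- compact object
  obtain ⟨F, k, d, hT⟩ := distinguished_cocone_triangle₁ (hocolimι Y s n ≫ ξ)
  obtain ⟨y, hy⟩ := exists_of_map_shift_mor₂_eq_zero K hT m (x := x) (eq_zero_of_isZero (hV m) _)
  obtain ⟨A, hA, a, b, hab⟩ := (compactlySupported_all hC hK (F⟦m⟧)).1 y
  obtain ⟨c, hc⟩ := (shiftFunctor C m).map_surjective
    (((shiftFunctorCompIsoId C (-m) m (by simp)).app A).hom ≫ a)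
  have hcs : (c ≫ k) ≫ s n = 0 := hs n _ (compactObjects_shift hA (-m)) _ (by
    have : k ≫ hocolimι Y s n ≫ ξ = 0 := comp_distTriang_mor_zero₁₂ _ hT
    change ((c ≫ k) ≫ hocolimι Y s n) ≫ ξ = 0
    simp only [Category.assoc, this, comp_zero])
  have has : (a ≫ k⟦m⟧') ≫ (s n)⟦m⟧' = 0 := by
    have := congrArg (fun φ => φ⟦m⟧') hcs
    simp only [Functor.map_comp, hc, Category.assoc, Functor.map_zero] at this
    rw [← cancel_epi ((shiftFunctorCompIsoId C (-m) m (by simp)).app A).hom, comp_zero,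
      Category.assoc]
    exact this
  change K.map ((s n)⟦m⟧') x = 0
  have hx : K.map (a ≫ k⟦m⟧') b = x := by
    rw [map_comp_elt, hab]
    exact hy
  rw [← hx, ← map_comp_elt, has, map_zero_elt]

/-- For the kernel of a homology theory, a weakly initial set in `X/ker K` consists of all morphisms
from `X` to those homotopy colimits in `ker K` of sequences of objects obtained from `X` by
attaching cells. -/
theorem hasWeaklyInitialSet_homologicalKernel (hC : IsCompactlyGeneratedCategory C)
    {K : C ⥤ AddCommGrpCat.{v}} (hK : IsHomologyTheory K) (X : C) :
    HasWeaklyInitialSet.{v} (ObjectsUnder X K.homologicalKernel) := by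
  obtain ⟨ι, g, -, hg⟩ := exists_compact_family hC
  let S := Σ (Y : ∀ n, cellObjects g X n) (s : ∀ n, (Y n).1 ⟶ (Y (n + 1)).1),
    {_p : X ⟶ hocolim (fun n => (Y n).1) s // K.homologicalKernel (hocolim (fun n => (Y n).1) s)}
  let φ (t : S) : ObjectsUnder X K.homologicalKernel :=
    StructuredArrow.mk (T := K.homologicalKernel.ι)
      (Y := (⟨_, t.2.2.2⟩ : K.homologicalKernel.FullSubcategory)) t.2.2.1
  refine ⟨Set.range φ, inferInstance, fun A => ?_⟩
  obtain ⟨Y, s, p, q, hY, hpq, hK'⟩ :=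
    exists_factor_homologicalKernel hC hK g hg A.right.property A.hom
  exact ⟨_, ⟨⟨fun n => ⟨Y n, hY n⟩, s, p, hK'⟩, rfl⟩,
    ⟨StructuredArrow.homMk (ObjectProperty.homMk q) hpq⟩⟩

/-! ### Brown representability -/

section Brown

variable {H : Cᵒᵖ ⥤ AddCommGrpCat.{w}}

/-- The five lemma for the comparison of a representable functor with a cohomological functor. -/
lemma bijective_pull_obj₂ (hH : IsCohomological H) {L : C} (ξ : H.obj (op L)) {T : Triangle C}
    (hT : T ∈ distTriang C)
    (h₁ : Function.Bijective fun f : T.obj₁ ⟶ L => pull H f ξ)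
    (h₁' : Function.Surjective fun f : T.obj₁⟦(1 : ℤ)⟧ ⟶ L => pull H f ξ)
    (h₃ : Function.Bijective fun f : T.obj₃ ⟶ L => pull H f ξ)
    (h₃' : Function.Injective fun f : T.obj₃⟦(-1 : ℤ)⟧ ⟶ L => pull H f ξ) :
    Function.Bijective fun f : T.obj₂ ⟶ L => pull H f ξ := by
  have := hH.additive
  have hinj {Z : C} (h : Function.Injective fun f : Z ⟶ L => pull H f ξ) {f : Z ⟶ L}
      (hf : pull H f ξ = 0) : f = 0 := h (hf.trans (pull_zero H ξ).symm)
  constructor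
  · suffices ∀ f : T.obj₂ ⟶ L, pull H f ξ = 0 → f = 0 by
      intro f f' hff'
      rw [← sub_eq_zero]
      exact this _ (by rw [pull_sub]; exact sub_eq_zero.2 hff')
    intro f hf
    have h0 : T.mor₁ ≫ f = 0 := hinj h₁.1 (by rw [pull_comp, hf, pull_zero_right])
    obtain ⟨f₃, rfl⟩ := Triangle.yoneda_exact₂ T hT f h0
    obtain ⟨z, hz⟩ := hH.exact _ (rot_of_distTriang T hT) (pull H f₃ ξ)
      ((pull_comp H T.mor₂ f₃ ξ).symm.trans hf)
    obtain ⟨k, rfl⟩ := h₁' z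
    have h1 : f₃ - T.mor₃ ≫ k = 0 := hinj h₃.1 (by
      rw [pull_sub, pull_comp, sub_eq_zero]
      exact hz.symm)
    rw [sub_eq_zero.1 h1, ← Category.assoc, comp_distTriang_mor_zero₂₃ T hT, zero_comp]
  · intro y
    obtain ⟨f₁, hf₁⟩ := h₁.2 (pull H T.mor₁ y)
    obtain ⟨c, hc, hc'⟩ : ∃ c : T.obj₃⟦(-1 : ℤ)⟧ ⟶ T.obj₁, c ≫ T.mor₁ = 0 ∧
        ∀ f₁ : T.obj₁ ⟶ L, c ≫ f₁ = 0 → ∃ f, f₁ = T.mor₁ ≫ f :=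
      ⟨T.invRotate.mor₁, comp_distTriang_mor_zero₁₂ _ (inv_rot_of_distTriang T hT),
        Triangle.yoneda_exact₂ _ (inv_rot_of_distTriang T hT)⟩
    dsimp only at hf₁
    obtain ⟨f, hf⟩ := hc' f₁ (hinj h₃' (by
      rw [pull_comp, hf₁, ← pull_comp, hc, pull_zero]))
    obtain ⟨z, hz⟩ := hH.exact T hT (y - pull H f ξ) (by
      rw [pull_sub_right, ← pull_comp, ← hf, sub_eq_zero]
      exact hf₁.symm)
    obtain ⟨f₃, rfl⟩ := h₃.2 z
    refine ⟨T.mor₂ ≫ f₃ + f, ?_⟩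
    dsimp only at hz ⊢
    rw [pull_add, pull_comp, hz, sub_add_cancel]

/-- **Brown representability**: in a compactly generated triangulated category, every cohomological
functor with small values is representable. -/
theorem exists_representing (hC : IsCompactlyGeneratedCategory C) (hH : IsCohomological H)
    (hsmall : ∀ X, Small.{v} (H.obj (op X))) :
    ∃ (L : C) (ξ : H.obj (op L)), ∀ Y, Function.Bijective fun f : Y ⟶ L => pull H f ξ := by
  have := hH.additive
  obtain ⟨ι, g, hg', hg⟩ := exists_compact_family hC
  obtain ⟨x, hx, -⟩ := hH.existsUnique (Σ i, Shrink.{v} (H.obj (op (g i)))) (fun t => g t.1)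
    fun t => (equivShrink _).symm t.2
  obtain ⟨Y, s, e, ξ, -, hξ, hs⟩ := hH.exists_telescope g hg _ x
  refine ⟨hocolim Y s, ξ, ?_⟩
  -- the starting object has one summand for each value of the functor on a compact object, which
  -- makes the comparison surjective there; injectivity is forced by the telescope
  let Q : ObjectProperty C := fun Z => Function.Bijective fun f : Z ⟶ hocolim Y s => pull H f ξ
  have hQ : Q.IsStableUnderRetracts := ⟨fun {X Z} h hZ => by
    refine ⟨fun f f' hf => ?_, fun y => ?_⟩
    · have : h.r ≫ f = h.r ≫ f' := hZ.1 (by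
        change pull H (h.r ≫ f) ξ = pull H (h.r ≫ f') ξ
        rw [pull_comp, pull_comp]
        exact congrArg _ hf)
      rw [← Category.id_comp f, ← Category.id_comp f', ← h.retract, Category.assoc, this,
        Category.assoc]
    · obtain ⟨f, hf⟩ := hZ.2 (pull H h.r y)
      refine ⟨h.i ≫ f, ?_⟩
      dsimp only at hf ⊢
      rw [pull_comp, hf, ← pull_comp, h.retract, pull_id]⟩
  have hcompact (A : C) (hA : compactObjects C A) : Q A := by
    constructor
    · suffices ∀ f : A ⟶ hocolim Y s, pull H f ξ = 0 → f = 0 by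
        intro f f' hff'
        rw [← sub_eq_zero]
        exact this _ (by rw [pull_sub]; exact sub_eq_zero.2 hff')
      intro f hf
      obtain ⟨n, f, rfl⟩ := exists_factor_hocolimι Y s hA f
      rw [← comp_hocolimι, ← Category.assoc, hs n A hA f hf, zero_comp]
    · intro y
      obtain ⟨i, ⟨a⟩⟩ := hg A hA
      let t : Σ i, Shrink.{v} (H.obj (op (g i))) := ⟨i, equivShrink _ (pull H a.inv y)⟩
      refine ⟨a.hom ≫ Sigma.ι (fun t : Σ i, Shrink.{v} (H.obj (op (g i))) => g t.1) t ≫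
        e ≫ hocolimι Y s 0, ?_⟩
      dsimp only
      rw [pull_comp, pull_comp, hξ, hx, Equiv.symm_apply_apply, ← pull_comp, a.hom_inv_id, pull_id]
  have hshift (Z : C) (hZ : ∀ n : ℤ, Q (Z⟦n⟧)) : Q Z := (prop_shift_zero_iff Q Z).1 (hZ 0)
  refine forall_prop_of_compact Q hC (fun A hA n => hcompact _ (compactObjects_shift hA n))
    (fun T hT h₁ h₃ => bijective_pull_obj₂ hH ξ hT (hshift _ h₁) (h₁ 1).2 (hshift _ h₃) (h₃ (-1)).1)
    (fun κ X hX => ⟨fun f f' hf => Sigma.hom_ext _ _ fun i => (hshift _ (hX i)).1 ?_, fun y => ?_⟩)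
    (fun X hX => hcompact X ((compactObjects C).prop_of_isZero hX))
  · dsimp only at hf ⊢
    rw [pull_comp, hf, pull_comp]
  · choose f hf using fun i => (hshift _ (hX i)).2 (pull H (Sigma.ι X i) y)
    refine ⟨Sigma.desc f, (hH.existsUnique κ X fun i => pull H (Sigma.ι X i) y).unique
      (fun i => ?_) fun i => rfl⟩
    dsimp only
    rw [← pull_comp, Sigma.ι_desc]
    exact hf i

end Brown

end Cells

/-! ### Verdier quotients -/

section Quotient

variable {C : Type u} [Category.{v} C] [HasZeroObject C] [HasShift C ℤ]
  [Preadditive C] [∀ n : ℤ, (shiftFunctor C n).Additive] [Pretriangulated C] [IsTriangulated C]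

section

variable (U : ObjectProperty C) [U.IsTriangulated]

/-- A morphism dies in the Verdier quotient if and only if it factors through an object of the
subcategory. -/
lemma Q_map_eq_zero_iff {X Y : C} (f : X ⟶ Y) :
    U.trW.Q.map f = 0 ↔ ∃ (V : C) (_ : U V) (a : X ⟶ V) (b : V ⟶ Y), a ≫ b = f := by
  rw [← U.trW.Q.map_zero X Y, MorphismProperty.map_eq_iff_postcomp U.trW.Q U.trW]
  constructor
  · rintro ⟨Z, s, hs, h⟩
    rw [U.trW_iff'] at hs
    obtain ⟨V, b, d, hT, hV⟩ := hs
    obtain ⟨a, ha⟩ : ∃ a, f = a ≫ b :=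
      Triangle.coyoneda_exact₂ _ hT f (h.trans zero_comp)
    exact ⟨V, hV, a, b, ha.symm⟩
  · rintro ⟨V, hV, a, b, rfl⟩
    obtain ⟨Z, s, d, hT⟩ := distinguished_cocone_triangle b
    refine ⟨Z, s, (U.trW_iff' s).2 ⟨V, b, d, hT, hV⟩, ?_⟩
    have : b ≫ s = 0 := comp_distTriang_mor_zero₁₂ _ hT
    rw [Category.assoc, this, comp_zero, zero_comp]

/-- If the categories `X/U` have weakly initial sets, the Verdier quotient is locally small:
any denominator `Z ⟶ X` with cone `V` in `U` is dominated by the fibre of `X ⟶ T`, where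
`X ⟶ T` is a member of the weakly initial set mapping to `X ⟶ V`. -/
theorem locallySmall_verdierQuotient
    (h : ∀ X : C, HasWeaklyInitialSet.{v} (ObjectsUnder X U)) :
    LocallySmall.{v} (VerdierQuotient U) := by
  constructor
  intro X' Y'
  obtain ⟨X, rfl⟩ := (Localization.Construction.objEquiv U.trW).surjective X'
  obtain ⟨Y, rfl⟩ := (Localization.Construction.objEquiv U.trW).surjective Y'
  change Small.{v} (U.trW.Q.obj X ⟶ U.trW.Q.obj Y)
  obtain ⟨S, _, hS⟩ := h X
  have hF (T : ObjectsUnder X U) : ∃ (F : C) (t : F ⟶ X), U.trW t ∧ t ≫ T.hom = 0 := by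
    obtain ⟨F, t, d, hT⟩ := distinguished_cocone_triangle₁ T.hom
    exact ⟨F, t, ⟨_, _, _, hT, T.right.property⟩, comp_distTriang_mor_zero₁₂ _ hT⟩
  choose F t ht hzero using hF
  have (T : ObjectsUnder X U) : IsIso (U.trW.Q.map (t T)) :=
    Localization.inverts U.trW.Q U.trW _ (ht T)
  refine small_of_surjective (α := Σ T : S, (F T.1 ⟶ Y))
    (f := fun p => inv (U.trW.Q.map (t p.1.1)) ≫ U.trW.Q.map p.2) fun φ => ?_
  obtain ⟨⟨s, ⟨V, c, d, hT, hV⟩, f⟩, rfl⟩ := Localization.exists_rightFraction U.trW.Q U.trW φ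
  let A : ObjectsUnder X U := StructuredArrow.mk (T := U.ι) (Y := (⟨V, hV⟩ : U.FullSubcategory)) c
  obtain ⟨T, hTS, ⟨r⟩⟩ := hS A
  have hr : T.hom ≫ r.right.hom = c := StructuredArrow.w r
  obtain ⟨k, hk⟩ : ∃ k, t T = k ≫ s := Triangle.coyoneda_exact₂ _ hT (t T) (by
    change t T ≫ c = 0
    rw [← hr, ← Category.assoc, hzero, zero_comp])
  refine ⟨⟨⟨T, hTS⟩, k ≫ f⟩, ?_⟩
  dsimp only
  rw [IsIso.inv_comp_eq, hk]
  simp only [Functor.map_comp, Category.assoc]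
  congr 1
  exact (MorphismProperty.RightFraction.map_s_comp_map
    (MorphismProperty.RightFraction.mk s ⟨V, c, d, hT, hV⟩ f) U.trW.Q _).symm

/-- The contravariant functor on `C` represented by `X` in the Verdier quotient. -/
noncomputable abbrev quotientYoneda (X : C) : Cᵒᵖ ⥤ AddCommGrpCat.{max u v} :=
  U.trW.Q.op ⋙ preadditiveYoneda.obj (U.trW.Q.obj X)

end

variable [HasCoproducts.{v} C]

section

variable {U : ObjectProperty C} [U.IsTriangulated] (hU : IsLocalising U) {ι : Type v} (Y : ι → C)
  {X : C}
include hU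

/-- Given left fractions `Y i ⟶ W i ⟵ X` where `X ⟶ W i` has fibre `V i` in `U`, the cone `W` of
`∐ V ⟶ X` receives morphisms from all the `W i` under `X`, so that `∐ Y ⟶ W ⟵ X` is a fraction
extending all the given ones. -/
lemma exists_Q_map_ι_comp_eq (y : ∀ i, U.trW.Q.obj (Y i) ⟶ U.trW.Q.obj X) :
    ∃ z : U.trW.Q.obj (∐ Y) ⟶ U.trW.Q.obj X, ∀ i, U.trW.Q.map (Sigma.ι Y i) ≫ z = y i := by
  choose φ hφ using fun i => Localization.exists_leftFraction U.trW.Q U.trW (y i)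
  choose V a d hT hV using fun i => (U.trW_iff' (φ i).s).1 (φ i).hs
  obtain ⟨W, s, d', hW⟩ := distinguished_cocone_triangle (Sigma.desc a)
  have hs : U.trW s := (U.trW_iff' s).2 ⟨_, _, _, hW,
    prop_coproduct_of_isClosedUnder U hU.isClosedUnderCoproducts V hV⟩
  have has (i : ι) : a i ≫ s = 0 := by
    have h0 : Sigma.desc a ≫ s = 0 := comp_distTriang_mor_zero₁₂ _ hW
    rw [← Sigma.ι_desc a i, Category.assoc, h0, comp_zero]
  have hk (i : ι) : ∃ k : (φ i).Y' ⟶ W, s = (φ i).s ≫ k :=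
    Triangle.yoneda_exact₂ _ (hT i) s (has i)
  choose k hk using hk
  have := Localization.inverts U.trW.Q U.trW s hs
  refine ⟨U.trW.Q.map (Sigma.desc fun i => (φ i).f ≫ k i) ≫ inv (U.trW.Q.map s), fun i => ?_⟩
  rw [← Category.assoc, ← Functor.map_comp, Sigma.ι_desc, IsIso.comp_inv_eq, hk i, hφ i,
    Functor.map_comp, Functor.map_comp, ← Category.assoc,
    MorphismProperty.LeftFraction.map_comp_map_s]

/-- If a left fraction `∐ Y ⟶ W ⟵ X` vanishes on each `Y i`, the morphisms `Y i ⟶ W` factor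
through objects of `U`, hence so does `∐ Y ⟶ W`. -/
lemma eq_zero_of_Q_map_ι_comp_eq_zero (z : U.trW.Q.obj (∐ Y) ⟶ U.trW.Q.obj X)
    (hz : ∀ i, U.trW.Q.map (Sigma.ι Y i) ≫ z = 0) : z = 0 := by
  obtain ⟨φ, hφ⟩ := Localization.exists_leftFraction U.trW.Q U.trW z
  have := Localization.inverts U.trW.Q U.trW φ.s φ.hs
  have hφs : z ≫ U.trW.Q.map φ.s = U.trW.Q.map φ.f := by
    rw [hφ, MorphismProperty.LeftFraction.map_comp_map_s]
  have hf (i : ι) : U.trW.Q.map (Sigma.ι Y i ≫ φ.f) = 0 := by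
    rw [Functor.map_comp, ← hφs, ← Category.assoc, hz, zero_comp]
  choose V hV a b hab using fun i => (Q_map_eq_zero_iff U _).1 (hf i)
  have h0 : U.trW.Q.map φ.f = 0 := by
    refine (Q_map_eq_zero_iff U _).2 ⟨∐ V,
      prop_coproduct_of_isClosedUnder U hU.isClosedUnderCoproducts V hV,
      Sigma.desc fun i => a i ≫ Sigma.ι V i, Sigma.desc b, Sigma.hom_ext _ _ fun i => ?_⟩
    rw [← hab, ← Category.assoc, Sigma.ι_desc, Category.assoc, Sigma.ι_desc]
  rw [← cancel_mono (U.trW.Q.map φ.s), hφs, h0, zero_comp]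

/-- Morphisms to `X` in the Verdier quotient by a localising subcategory form a cohomological
functor. -/
theorem isCohomological_quotientYoneda (X : C) : IsCohomological (quotientYoneda U X) where
  additive := inferInstance
  exact T hT x hx := by
    obtain ⟨y, hy⟩ := Triangle.yoneda_exact₂ _ (U.trW.Q.map_distinguished T hT) x hx
    exact ⟨y, hy.symm⟩
  existsUnique ι Y y := by
    refine existsUnique_of_exists_of_unique (exists_Q_map_ι_comp_eq hU Y y) fun z z' hz hz' =>
      sub_eq_zero.1 (eq_zero_of_Q_map_ι_comp_eq_zero hU Y (X := X) (z - z') fun i => ?_)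
    refine (Preadditive.comp_sub _ _ _).trans (sub_eq_zero.2 ?_)
    exact (hz i).trans (hz' i).symm

end

omit [HasCoproducts.{v} C] [IsTriangulated C] in
/-- In a distinguished triangle whose outer terms lie in `U` and in its right orthogonal, the
two morphisms have the universal properties required of a Bousfield localisation triangle. -/
lemma bousfieldTriangle_universal {U : ObjectProperty C} [U.IsTriangulated]
    {CX X LX : C} {q : CX ⟶ X} {j : X ⟶ LX} {d : LX ⟶ CX⟦(1 : ℤ)⟧}
    (hT : Triangle.mk q j d ∈ distTriang C) (hCX : U CX) (hLX : U.rightOrthogonal LX) :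
    Nonempty (IsTerminal (CostructuredArrow.mk (S := U.ι)
      (Y := (⟨CX, hCX⟩ : U.FullSubcategory)) q : ObjectsOver U X)) ∧
    Nonempty (IsInitial (StructuredArrow.mk (T := U.rightOrthogonal.ι)
      (Y := (⟨LX, hLX⟩ : U.rightOrthogonal.FullSubcategory)) j :
        ObjectsUnder X U.rightOrthogonal)) := by
  have hq (V : C) (hV : U V) (f : V ⟶ X) : ∃ k : V ⟶ CX, f = k ≫ q :=
    Triangle.coyoneda_exact₂ _ hT f (hLX _ hV)
  have hq' (V : C) (hV : U V) (k : V ⟶ CX) (hk : k ≫ q = 0) : k = 0 := by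
    obtain ⟨l, rfl⟩ := Triangle.coyoneda_exact₂ _ (inv_rot_of_distTriang _ hT) k hk
    have h0 : l = 0 := U.rightOrthogonal.le_shift (-1) _ hLX l hV
    rw [h0]
    exact zero_comp
  have hj (Z : C) (hZ : U.rightOrthogonal Z) (f : X ⟶ Z) : ∃ k : LX ⟶ Z, f = j ≫ k :=
    Triangle.yoneda_exact₂ _ hT f (hZ _ hCX)
  have hj' (Z : C) (hZ : U.rightOrthogonal Z) (k : LX ⟶ Z) (hk : j ≫ k = 0) : k = 0 := by
    obtain ⟨l, rfl⟩ := Triangle.yoneda_exact₃ _ hT k hk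
    have h0 : l = 0 := hZ l (U.le_shift 1 _ hCX)
    rw [h0]
    exact comp_zero
  constructor
  · choose k hk using fun A : ObjectsOver U X => hq A.left.obj A.left.property A.hom
    refine ⟨IsTerminal.ofUniqueHom
      (fun A => CostructuredArrow.homMk (ObjectProperty.homMk (k A)) (hk A).symm) fun A m => ?_⟩
    have hm : m.left.hom ≫ q = A.hom := CostructuredArrow.w m
    ext
    change m.left.hom = k A
    rw [← sub_eq_zero]
    exact hq' _ A.left.property _ (by rw [Preadditive.sub_comp, hm, ← hk A]; exact sub_self _)
  · choose k hk using fun A : ObjectsUnder X U.rightOrthogonal =>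
      hj A.right.obj A.right.property A.hom
    refine ⟨IsInitial.ofUniqueHom
      (fun A => StructuredArrow.homMk (ObjectProperty.homMk (k A)) (hk A).symm) fun A m => ?_⟩
    have hm : j ≫ m.right.hom = A.hom := StructuredArrow.w m
    ext
    change m.right.hom = k A
    rw [← sub_eq_zero]
    exact hj' _ A.right.property _ (by rw [Preadditive.comp_sub, hm, ← hk A]; exact sub_self _)

/-- If the Verdier quotient by a localising subcategory is locally small, Brown representability
provides a right adjoint of the quotient functor, hence Bousfield localisation triangles. -/
theorem hasBousfieldTriangles_of_locallySmall (hC : IsCompactlyGeneratedCategory C)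
    {U : ObjectProperty C} (hU : IsLocalising U) (hsmall : LocallySmall.{v} (VerdierQuotient U)) :
    HasBousfieldTriangles U := by
  intro X
  have := hU.isTriangulated
  have := hU.isStableUnderRetracts
  obtain ⟨L, ξ, hξ⟩ := exists_representing hC (isCohomological_quotientYoneda hU X) fun Y =>
    (inferInstance : Small.{v} (U.trW.Q.obj Y ⟶ U.trW.Q.obj X))
  change U.trW.Q.obj L ⟶ U.trW.Q.obj X at ξ
  replace hξ (Y : C) : Function.Bijective fun f : Y ⟶ L => U.trW.Q.map f ≫ ξ := hξ Y
  have hL : U.rightOrthogonal L := fun V f hV => (hξ V).1 (by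
    have : U.trW.Q.map f = 0 := (Q_map_eq_zero_iff U f).2 ⟨V, hV, 𝟙 V, f, Category.id_comp f⟩
    dsimp only
    rw [this, U.trW.Q.map_zero])
  obtain ⟨j, hj⟩ := (hξ X).2 (𝟙 _)
  dsimp only at hj
  -- since `L` is local, `ξ ≫ Q j` comes from an endomorphism of `L`, which has to be the identity
  have hj' : ξ ≫ U.trW.Q.map j = 𝟙 _ := by
    obtain ⟨e, he⟩ := (ObjectProperty.rightOrthogonal.map_bijective_of_isTriangulated
      hL U.trW.Q L).2 (ξ ≫ U.trW.Q.map j)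
    have : e = 𝟙 L := (hξ L).1 (by
      dsimp only
      rw [he, Category.assoc, hj, Category.comp_id, CategoryTheory.Functor.map_id,
        Category.id_comp])
    rw [← he, this, CategoryTheory.Functor.map_id]
  obtain ⟨F, q, d, hT⟩ := distinguished_cocone_triangle₁ j
  have hF : U F := by
    have hiso : IsIso (U.trW.Q.map j) := ⟨ξ, hj, hj'⟩
    have hz : IsZero (U.trW.Q.obj F) :=
      (Triangle.isZero₁_iff_isIso₂ _ (U.trW.Q.map_distinguished _ hT)).2 hiso
    obtain ⟨V, hV, a, b, hab⟩ := (Q_map_eq_zero_iff U (𝟙 F)).1 (hz.eq_of_src _ _)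
    exact U.prop_of_retract ⟨a, b, hab⟩ hV
  exact ⟨F, L, q, j, d, hF, hL, hT, bousfieldTriangle_universal hT hF hL⟩

end Quotient

end BousfieldLoc

theorem mainTheorem12 (C : Type u) [Category.{v} C] [HasZeroObject C] [HasShift C ℤ]
    [Preadditive C] [∀ n : ℤ, (shiftFunctor C n).Additive] [Pretriangulated C]
    [IsTriangulated C] [HasCoproducts.{v} C]
    (hC : BousfieldLoc.IsCompactlyGeneratedCategory C) :
    (∀ K : C ⥤ AddCommGrpCat.{v}, BousfieldLoc.IsHomologyTheory K →
      BousfieldLoc.IsLocalising K.homologicalKernel ∧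
      (∀ X : C, BousfieldLoc.HasWeaklyInitialSet.{v}
        (BousfieldLoc.ObjectsUnder X K.homologicalKernel)) ∧
      LocallySmall.{v} (BousfieldLoc.VerdierQuotient K.homologicalKernel) ∧
      BousfieldLoc.HasBousfieldTriangles K.homologicalKernel) ∧
    (∀ U : ObjectProperty C, BousfieldLoc.IsLocalising U →
      LocallySmall.{v} (BousfieldLoc.VerdierQuotient U) →
      BousfieldLoc.HasBousfieldTriangles U) := by
  refine ⟨fun K hK => ?_, fun U hU hsmall =>
    BousfieldLoc.hasBousfieldTriangles_of_locallySmall hC hU hsmall⟩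
  have := hK.isHomological
  have hU := BousfieldLoc.isLocalising_homologicalKernel hK
  have hw := BousfieldLoc.hasWeaklyInitialSet_homologicalKernel hC hK
  have hsmall := BousfieldLoc.locallySmall_verdierQuotient _ hw
  exact ⟨hU, hw, hsmall, BousfieldLoc.hasBousfieldTriangles_of_locallySmall hC hU hsmall⟩
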